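/- Let $\alpha>1$, let $m(\xi)=(1+\xi^2)^{-\alpha/2}$ for $\xi\in\mathbb R$, let $K(x)=\frac1{2\pi}\int_{\mathbb R} m(\xi)\,e^{ix\xi}\,d\xi$, and let $L$ be the corresponding Fourier multiplier operator $Lf(x)=(K*f)(x)=\int_{\mathbb R}K(x-y)f(y)\,dy$ for bounded measurable $f:\mathbb R\to\mathbb R$. Let $\mu\in\mathbb R$ and let $\varphi:\mathbb R\to\mathbb R$ be a bounded measurable function (for instance a $2\pi$-periodic one) which satisfies $$\tfrac12(\mu-\varphi(x))^2=\tfrac12\mu^2-L\varphi(x)\qquad\text{for every }x\in\mathbb R,$$ and suppose that $\varphi(x)\le\mu$ for every $x\in\mathbb R$. Then: (i) if $\varphi<\mu$ uniformly, that is, if there is $\varepsilon>0$ with $\varphi(x)\le\mu-\varepsilon$ for all $x\in\mathbb R$, then $\varphi\in C^\infty(\mathbb R)$; (ii) if $U\subseteq\mathbb R$ is open and $\varphi(x)<\mu$ for every $x\in U$, then $\varphi$ is $C^\infty$ on $U$. -/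

import Mathlib

open MeasureTheory
open scoped ContDiff

noncomputable section

/-- The Bessel potential symbol `m(ξ) = (1 + ξ²)^(-α/2)`. -/
def besselSymbol (α ξ : ℝ) : ℝ := (1 + ξ ^ 2) ^ (-α / 2)

/-- The kernel `K(x) = (1 / 2π) ∫ m(ξ) exp(i x ξ) dξ`, the inverse Fourier transform of the symbol
(for the convention `f̂(ξ) = ∫ f(x) exp(-i x ξ) dx`). For `α > 1` the integrand is absolutely
integrable; the integral is real because `m` is even, and we record it as a real number. -/
def besselKernel (α x : ℝ) : ℝ :=
  ((1 / (2 * Real.pi) : ℂ) *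
    ∫ ξ : ℝ, (besselSymbol α ξ : ℂ) * Complex.exp (Complex.I * (x : ℂ) * (ξ : ℂ))).re

/-- The operator `L f = K * f` with Fourier multiplier `m`, on bounded measurable functions:
`(L f)(x) = ∫ K(x - y) f(y) dy`. -/
def besselOp (α : ℝ) (f : ℝ → ℝ) (x : ℝ) : ℝ :=
  ∫ y : ℝ, besselKernel α (x - y) * f y

/-- A (bounded, real-valued) solution `φ : ℝ → ℝ` with wave speed `μ` of the steady equation
`(μ - φ)² / 2 = μ² / 2 - L φ`, required to hold at every point. Periodicity is not required. -/
structure IsBoundedSolution (α μ : ℝ) (φ : ℝ → ℝ) : Prop where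
  /-- `φ` is Lebesgue measurable. -/
  aestronglyMeasurable : AEStronglyMeasurable φ volume
  /-- `φ` is bounded. -/
  bounded : ∃ C : ℝ, ∀ x : ℝ, |φ x| ≤ C
  /-- The equation holds pointwise. -/
  equation : ∀ x : ℝ, (1 / 2 : ℝ) * (μ - φ x) ^ 2 = (1 / 2 : ℝ) * μ ^ 2 - besselOp α φ x

end

open Set Filter Topology
open scoped Convolution

noncomputable section

/-! Because φ ≤ μ, the equation can be solved as φ = μ - √(μ² - 2Lφ). The radicand is (μ - φ)², so
wherever φ < μ the function φ is as smooth as Lφ, and it suffices that L gains one derivative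
locally. Globally, the gain comes from K' ∈ L¹ (`integrable_deriv_besselKernel`,
`contDiff_besselOp`). Since L is nonlocal, φ is split by a cutoff at a point of U
(`exists_localization`): the part supported in U gains a derivative, and the part vanishing near the
point contributes an analytic function there. Induction on n then gives C^n on U for all n.
Everything about K is read off from K(x) = c ∫ t^((α-3)/2) exp(-t - x²/(4t)) dt, which extends
holomorphically to re (w²) > 0 and decays there. -/

/-! ### The heat integral: decay and holomorphy -/

lemma rpow_le_const_mul_exp {s u : ℝ} (hs : 0 < s) (hu : 0 ≤ u) :
    u ^ s ≤ s ^ s * Real.exp u := by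
  have h1 : u / s ≤ Real.exp (u / s) := by linarith [Real.add_one_le_exp (u / s)]
  have h2 : (u / s) ^ s ≤ Real.exp (u / s) ^ s :=
    Real.rpow_le_rpow (by positivity) h1 hs.le
  rw [← Real.exp_mul, div_mul_cancel₀ _ hs.ne', Real.div_rpow hu hs.le,
    div_le_iff₀ (by positivity)] at h2
  linarith

/-- The integrand `t ^ β * exp (-t - w ^ 2 / (4 t))`, as a function of `w` and `t`. -/
def heatIntegrand (β : ℝ) (w : ℂ) (t : ℝ) : ℂ :=
  ((t ^ β * Real.exp (-t) : ℝ) : ℂ) * Complex.exp (-w ^ 2 / (4 * t))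

/-- The Macdonald-type integral `∫ t ^ β * exp (-t - w ^ 2 / (4 t))` over `t > 0`. -/
def heatIntegral (β : ℝ) (w : ℂ) : ℂ := ∫ t in Ioi (0 : ℝ), heatIntegrand β w t

lemma measurable_heatIntegrand (β : ℝ) :
    Measurable (fun p : ℂ × ℝ => heatIntegrand β p.1 p.2) := by
  unfold heatIntegrand
  fun_prop

lemma measurable_heatIntegral (β : ℝ) : Measurable (heatIntegral β) :=
  ((measurable_heatIntegrand β).stronglyMeasurable.integral_prod_right'
    (ν := volume.restrict (Ioi (0 : ℝ)))).measurable

lemma norm_heatIntegrand (β : ℝ) (w : ℂ) {t : ℝ} (ht : 0 < t) :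
    ‖heatIntegrand β w t‖ = t ^ β * Real.exp (-t) * Real.exp (-((w ^ 2).re / (4 * t))) := by
  have h4 : (4 * t : ℂ) = ((4 * t : ℝ) : ℂ) := by push_cast; rfl
  rw [heatIntegrand, norm_mul, Complex.norm_real, Real.norm_of_nonneg (by positivity),
    Complex.norm_exp, h4, Complex.div_ofReal_re, Complex.neg_re, neg_div]

lemma integrableOn_rpow_mul_exp_neg {γ : ℝ} (hγ : -1 < γ) :
    IntegrableOn (fun t : ℝ => t ^ γ * Real.exp (-t)) (Ioi 0) := by
  have := Real.GammaIntegral_convergent (s := γ + 1) (by linarith)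
  simpa [mul_comm] using this

/-- The Gaussian is traded for a power through exp(-u) ≤ s^s u^(-s) with u = ρ/(4t). This raises the
exponent of t by s at the price of ρ^(-s); the free s later serves both the singularity at 0 and the
decay at infinity. -/
lemma norm_heatIntegrand_le {β s ρ : ℝ} (hs : 0 < s) (hρ : 0 < ρ) {w : ℂ}
    (hw : ρ ≤ (w ^ 2).re) {t : ℝ} (ht : 0 < t) :
    ‖heatIntegrand β w t‖ ≤ (4 * s) ^ s * ρ ^ (-s) * (t ^ (β + s) * Real.exp (-t)) := by
  rw [norm_heatIntegrand β w ht]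
  have hu : 0 < ρ / (4 * t) := by positivity
  have h1 : Real.exp (-((w ^ 2).re / (4 * t))) ≤ Real.exp (-(ρ / (4 * t))) := by
    gcongr
  have h2 : Real.exp (-(ρ / (4 * t))) ≤ s ^ s * (ρ / (4 * t)) ^ (-s) := by
    rw [Real.exp_neg, Real.rpow_neg hu.le, ← div_eq_mul_inv, inv_eq_one_div,
      div_le_div_iff₀ (Real.exp_pos _) (by positivity)]
    linarith [rpow_le_const_mul_exp hs hu.le]
  have h3 : s ^ s * (ρ / (4 * t)) ^ (-s) = (4 * s) ^ s * ρ ^ (-s) * t ^ s := by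
    rw [Real.div_rpow hρ.le (by positivity), Real.rpow_neg (by positivity : 0 ≤ 4 * t),
      Real.mul_rpow (by norm_num) ht.le, Real.mul_rpow (by norm_num) hs.le]
    field_simp
  calc _ ≤ t ^ β * Real.exp (-t) * ((4 * s) ^ s * ρ ^ (-s) * t ^ s) := by
        gcongr
        exact h1.trans (h2.trans_eq h3)
    _ = _ := by rw [Real.rpow_add ht]; ring

lemma integrableOn_heatIntegrand (β : ℝ) {w : ℂ} (hw : 0 < (w ^ 2).re) :
    IntegrableOn (heatIntegrand β w) (Ioi 0) := by
  refine Integrable.mono' (((integrableOn_rpow_mul_exp_neg (γ := β + (|β| + 1))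
    (by linarith [neg_abs_le β])).const_mul
      ((4 * (|β| + 1)) ^ (|β| + 1) * (w ^ 2).re ^ (-(|β| + 1))))) ?_ ?_
  · exact ((measurable_heatIntegrand β).comp (measurable_const.prodMk measurable_id)).aestronglyMeasurable
  · filter_upwards [ae_restrict_mem measurableSet_Ioi] with t ht
    exact norm_heatIntegrand_le (by positivity) hw le_rfl ht

/-- Algebraic decay of `heatIntegral β` in the sector `0 < re (w ^ 2)`. -/
lemma exists_norm_heatIntegral_le {β s : ℝ} (hs : 0 < s) (hβ : -1 < β + s) :
    ∃ C : ℝ, 0 ≤ C ∧ ∀ w : ℂ, 0 < (w ^ 2).re →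
      ‖heatIntegral β w‖ ≤ C * (w ^ 2).re ^ (-s) := by
  refine ⟨(4 * s) ^ s * ∫ t in Ioi (0 : ℝ), t ^ (β + s) * Real.exp (-t), ?_, fun w hw => ?_⟩
  · refine mul_nonneg (by positivity) (setIntegral_nonneg measurableSet_Ioi fun t ht => ?_)
    have : 0 < t := ht
    positivity
  · have h := norm_integral_le_of_norm_le (f := heatIntegrand β w)
      (μ := volume.restrict (Ioi (0 : ℝ)))
      ((integrableOn_rpow_mul_exp_neg hβ).const_mul ((4 * s) ^ s * (w ^ 2).re ^ (-s))) (by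
        filter_upwards [ae_restrict_mem measurableSet_Ioi] with t ht
        exact norm_heatIntegrand_le hs hw le_rfl ht)
    rw [integral_const_mul] at h
    rw [heatIntegral]
    linarith

lemma hasDerivAt_heatIntegrand (β : ℝ) (w : ℂ) {t : ℝ} (ht : 0 < t) :
    HasDerivAt (fun z => heatIntegrand β z t) (-(w / 2) * heatIntegrand (β - 1) w t) w := by
  have h : HasDerivAt (fun z : ℂ => -z ^ 2 / (4 * t)) (-(2 * w) / (4 * t)) w := by
    simpa using ((hasDerivAt_pow 2 w).neg.div_const (4 * (t : ℂ)))
  have h2 := h.cexp.const_mul ((t ^ β * Real.exp (-t) : ℝ) : ℂ)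
  refine h2.congr_deriv ?_
  have ht' : (t : ℂ) ≠ 0 := by exact_mod_cast ht.ne'
  rw [heatIntegrand, Real.rpow_sub_one ht.ne']
  push_cast
  field_simp
  ring

lemma hasDerivAt_heatIntegral (β : ℝ) {w : ℂ} (hw : 0 < (w ^ 2).re) :
    HasDerivAt (heatIntegral β) (-(w / 2) * heatIntegral (β - 1) w) w := by
  set ρ := (w ^ 2).re / 2 with hρ
  have hρ0 : 0 < ρ := by positivity
  -- Makes β - 1 + s ≥ 0, so the dominating function is integrable at t = 0.
  set s := |β| + 1 with hs
  have hs0 : 0 < s := by positivity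
  have hnhds : {z : ℂ | ρ < (z ^ 2).re ∧ ‖z‖ < ‖w‖ + 1} ∈ 𝓝 w := by
    have h1 : Continuous fun z : ℂ => (z ^ 2).re := by fun_prop
    exact ((h1.tendsto w).eventually (lt_mem_nhds (by linarith))).and
      ((continuous_norm.tendsto w).eventually (gt_mem_nhds (by linarith)))
  have key := (hasDerivAt_integral_of_dominated_loc_of_deriv_le
    (μ := volume.restrict (Ioi (0 : ℝ))) (F := heatIntegrand β)
    (F' := fun z t => -(z / 2) * heatIntegrand (β - 1) z t)
    (bound := fun t => (‖w‖ + 1) * ((4 * s) ^ s * ρ ^ (-s) * (t ^ (β - 1 + s) * Real.exp (-t))))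
    hnhds ?_ (integrableOn_heatIntegrand β hw) ?_ ?_ ?_ ?_).2
  · rw [integral_const_mul] at key
    exact key
  · exact Eventually.of_forall fun z => ((measurable_heatIntegrand β).comp
      (measurable_const.prodMk measurable_id)).aestronglyMeasurable
  · exact (((measurable_heatIntegrand (β - 1)).comp
      (measurable_const.prodMk measurable_id)).const_mul _).aestronglyMeasurable
  · filter_upwards [ae_restrict_mem measurableSet_Ioi] with t ht z hz
    have h1 := norm_heatIntegrand_le (β := β - 1) hs0 hρ0 hz.1.le ht
    rw [norm_mul]
    refine mul_le_mul ?_ h1 (norm_nonneg _) (by positivity)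
    rw [norm_neg, norm_div]
    have := hz.2
    have h2 : ‖(2 : ℂ)‖ = 2 := by simp
    rw [h2]
    linarith [norm_nonneg z]
  · exact ((integrableOn_rpow_mul_exp_neg (by linarith [neg_abs_le β])).const_mul _).const_mul _
  · filter_upwards [ae_restrict_mem measurableSet_Ioi] with t ht z hz
    exact hasDerivAt_heatIntegrand β z ht

/-! ### The kernel as a heat integral -/

lemma integrable_besselSymbol {α : ℝ} (hα : 1 < α) : Integrable (besselSymbol α) := by
  have := integrable_rpow_neg_one_add_norm_sq (E := ℝ) (μ := volume) (r := α) (by simpa using hα)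
  exact this.congr (Eventually.of_forall fun ξ => by simp [besselSymbol])

lemma integral_rpow_mul_exp_eq_besselSymbol {α : ℝ} (hα : 0 < α) (ξ : ℝ) :
    ∫ t in Ioi (0 : ℝ), t ^ (α / 2 - 1) * Real.exp (-((1 + ξ ^ 2) * t)) =
      Real.Gamma (α / 2) * besselSymbol α ξ := by
  rw [Real.integral_rpow_mul_exp_neg_mul_Ioi (by positivity) (by positivity), besselSymbol,
    neg_div, Real.rpow_neg (by positivity), one_div, Real.inv_rpow (by positivity), mul_comm]

lemma integrableOn_rpow_mul_exp {a r : ℝ} (ha : 0 < a) (hr : 0 < r) :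
    IntegrableOn (fun t : ℝ => t ^ (a - 1) * Real.exp (-(r * t))) (Ioi 0) := by
  refine Integrable.of_integral_ne_zero ?_
  rw [Real.integral_rpow_mul_exp_neg_mul_Ioi ha hr]
  have := Real.Gamma_pos_of_pos ha
  positivity

/-- Subordination: the symbol is a Gamma integral of Gaussians in ξ. Fubini applies since the symbol
is integrable, and each Gaussian transform contributes √(π/t), turning the exponent α/2 - 1 into (α
- 3)/2. -/
lemma integral_besselSymbol_mul_exp {α : ℝ} (hα : 1 < α) (x : ℝ) :
    (Real.Gamma (α / 2) : ℂ) *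
      ∫ ξ : ℝ, (besselSymbol α ξ : ℂ) * Complex.exp (Complex.I * (x : ℂ) * (ξ : ℂ)) =
    (√Real.pi : ℂ) * heatIntegral ((α - 3) / 2) x := by
  have hα0 : 0 < α := by linarith
  set F : ℝ → ℝ → ℂ := fun ξ t =>
    ((t ^ (α / 2 - 1) * Real.exp (-((1 + ξ ^ 2) * t)) : ℝ) : ℂ) *
      Complex.exp (Complex.I * (x : ℂ) * (ξ : ℂ)) with hF
  have hexp : ∀ ξ : ℝ, ‖Complex.exp (Complex.I * (x : ℂ) * (ξ : ℂ))‖ = 1 := fun ξ => by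
    rw [mul_assoc, ← Complex.ofReal_mul, Complex.norm_exp_I_mul_ofReal]
  have hmeas : Measurable (Function.uncurry F) := by
    simp only [hF, Function.uncurry_def]
    fun_prop
  have hnorm : ∀ ξ, ∫ t in Ioi (0 : ℝ), ‖F ξ t‖ = Real.Gamma (α / 2) * besselSymbol α ξ := by
    intro ξ
    rw [← integral_rpow_mul_exp_eq_besselSymbol hα0]
    refine setIntegral_congr_fun measurableSet_Ioi fun t ht => ?_
    have : 0 < t := ht
    simp only [hF]
    rw [norm_mul, hexp, mul_one, Complex.norm_real, Real.norm_of_nonneg (by positivity)]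
  have hint : Integrable (Function.uncurry F) (volume.prod (volume.restrict (Ioi (0 : ℝ)))) := by
    rw [integrable_prod_iff hmeas.aestronglyMeasurable]
    refine ⟨Eventually.of_forall fun ξ => ?_, ?_⟩
    · exact ((integrableOn_rpow_mul_exp (a := α / 2) (r := 1 + ξ ^ 2) (by positivity)
        (by positivity)).ofReal (𝕜 := ℂ)).mul_const (Complex.exp (Complex.I * x * ξ))
    · simp only [Function.uncurry_apply_pair, hnorm]
      exact (integrable_besselSymbol hα).const_mul _
  calc _ = ∫ ξ : ℝ, ∫ t in Ioi (0 : ℝ), F ξ t := by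
        rw [← integral_const_mul]
        congr 1 with ξ
        simp only [hF]
        rw [integral_mul_const, integral_complex_ofReal,
          integral_rpow_mul_exp_eq_besselSymbol hα0]
        push_cast
        ring
    _ = ∫ t in Ioi (0 : ℝ), ∫ ξ : ℝ, F ξ t := integral_integral_swap hint
    _ = ∫ t in Ioi (0 : ℝ), (√Real.pi : ℂ) * heatIntegrand ((α - 3) / 2) x t := by
        refine setIntegral_congr_fun measurableSet_Ioi fun t ht => ?_
        have ht : 0 < t := ht
        have hF' : ∀ ξ : ℝ, F ξ t = ((t ^ (α / 2 - 1) * Real.exp (-t) : ℝ) : ℂ) *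
            (Complex.exp (Complex.I * (x : ℂ) * (ξ : ℂ)) * Complex.exp (-(t : ℂ) * (ξ : ℂ) ^ 2)) := by
          intro ξ
          have : Real.exp (-((1 + ξ ^ 2) * t)) = Real.exp (-t) * Real.exp (-t * ξ ^ 2) := by
            rw [← Real.exp_add]; ring_nf
          simp only [hF, this]
          push_cast
          ring
        have hroot : ((Real.pi : ℂ) / t) ^ (1 / 2 : ℂ) = ((√Real.pi * t ^ (-(1 / 2) : ℝ) : ℝ) : ℂ) := by
          rw [Real.sqrt_eq_rpow, Real.rpow_neg ht.le, ← div_eq_mul_inv,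
            ← Real.div_rpow Real.pi_pos.le ht.le, Complex.ofReal_cpow (by positivity)]
          push_cast
          rfl
        have hpow : t ^ ((α - 3) / 2) = t ^ (α / 2 - 1) * t ^ (-(1 / 2) : ℝ) := by
          rw [← Real.rpow_add ht]; ring_nf
        simp only [hF']
        rw [integral_const_mul, fourierIntegral_gaussian (by simpa using ht), hroot,
          heatIntegrand, hpow]
        push_cast
        ring
    _ = _ := by rw [integral_const_mul, heatIntegral]

/-- The normalising constant relating `besselKernel` to `heatIntegral`. -/
def besselConst (α : ℝ) : ℝ := 1 / (2 * Real.pi) * (√Real.pi / Real.Gamma (α / 2))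

lemma besselKernel_eq {α : ℝ} (hα : 1 < α) (x : ℝ) :
    besselKernel α x = besselConst α * (heatIntegral ((α - 3) / 2) x).re := by
  have hΓ : (Real.Gamma (α / 2) : ℂ) ≠ 0 := by
    exact_mod_cast (Real.Gamma_pos_of_pos (by linarith : 0 < α / 2)).ne'
  have h := integral_besselSymbol_mul_exp hα x
  rw [mul_comm, ← eq_div_iff hΓ] at h
  rw [besselKernel, h, ← Complex.re_ofReal_mul]
  congr 1
  rw [besselConst]
  push_cast
  ring

/-! ### Integrability of the kernel and its derivative -/

lemma continuous_besselKernel {α : ℝ} (hα : 1 < α) : Continuous (besselKernel α) := by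
  refine Complex.continuous_re.comp (continuous_const.mul ?_)
  refine continuous_of_dominated (bound := fun ξ => ‖besselSymbol α ξ‖) (fun x => ?_) (fun x => ?_)
    (integrable_besselSymbol hα).norm (Eventually.of_forall fun ξ => by fun_prop)
  · exact (integrable_besselSymbol hα).ofReal.aestronglyMeasurable.mul
      (by fun_prop)
  · refine Eventually.of_forall fun ξ => ?_
    rw [norm_mul, mul_assoc, ← Complex.ofReal_mul, Complex.norm_exp_I_mul_ofReal, mul_one,
      Complex.norm_real]

lemma exists_abs_besselKernel_le (α : ℝ) : ∃ M : ℝ, ∀ x, |besselKernel α x| ≤ M := by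
  refine ⟨‖(1 / (2 * Real.pi) : ℂ)‖ * ∫ ξ, ‖besselSymbol α ξ‖, fun x => ?_⟩
  refine (Complex.abs_re_le_norm _).trans ?_
  rw [norm_mul]
  refine mul_le_mul_of_nonneg_left ((norm_integral_le_integral_norm _).trans_eq ?_) (norm_nonneg _)
  congr 1 with ξ
  rw [norm_mul, mul_assoc, ← Complex.ofReal_mul, Complex.norm_exp_I_mul_ofReal, mul_one,
      Complex.norm_real]

lemma ofReal_sq_re (x : ℝ) : ((x : ℂ) ^ 2).re = x ^ 2 := by
  rw [← Complex.ofReal_pow, Complex.ofReal_re]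

lemma integrable_besselKernel {α : ℝ} (hα : 1 < α) : Integrable (besselKernel α) := by
  obtain ⟨M, hM⟩ := exists_abs_besselKernel_le α
  obtain ⟨C, hC0, hC⟩ := exists_norm_heatIntegral_le (β := (α - 3) / 2) (s := 1) one_pos
    (by linarith)
  refine (integrable_inv_one_add_sq.const_mul (M + |besselConst α| * C)).mono'
    (continuous_besselKernel hα).aestronglyMeasurable (Eventually.of_forall fun x => ?_)
  rw [← div_eq_mul_inv, le_div_iff₀ (by positivity), mul_add, mul_one, Real.norm_eq_abs]
  refine add_le_add (hM x) ?_
  rcases eq_or_ne x 0 with rfl | hx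
  · simp; positivity
  have h := hC x (by rw [ofReal_sq_re]; positivity)
  rw [ofReal_sq_re, Real.rpow_neg_one, ← div_eq_mul_inv, le_div_iff₀ (by positivity)] at h
  rw [besselKernel_eq hα, abs_mul, mul_assoc]
  refine mul_le_mul_of_nonneg_left ?_ (abs_nonneg _)
  refine le_trans ?_ h
  gcongr
  exact Complex.abs_re_le_norm _

lemma hasDerivAt_besselKernel {α : ℝ} (hα : 1 < α) {x : ℝ} (hx : x ≠ 0) :
    HasDerivAt (besselKernel α)
      (besselConst α * (-(x / 2 : ℂ) * heatIntegral ((α - 3) / 2 - 1) x).re) x := by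
  have h := (hasDerivAt_heatIntegral ((α - 3) / 2) (w := (x : ℂ))
    (by rw [ofReal_sq_re]; positivity)).real_of_complex.const_mul (besselConst α)
  rwa [← funext (besselKernel_eq hα)] at h

lemma exists_abs_deriv_besselKernel_le {α s : ℝ} (hα : 1 < α) (hs : 0 < s)
    (hs' : (3 - α) / 2 < s) :
    ∃ C : ℝ, ∀ x, x ≠ 0 → |deriv (besselKernel α) x| ≤ C * |x| ^ (1 - 2 * s) := by
  obtain ⟨C, hC0, hC⟩ := exists_norm_heatIntegral_le (β := (α - 3) / 2 - 1) hs (by linarith)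
  refine ⟨|besselConst α| * C, fun x hx => ?_⟩
  have h := hC x (by rw [ofReal_sq_re]; positivity)
  have hx' : 0 < |x| := abs_pos.2 hx
  rw [(hasDerivAt_besselKernel hα hx).deriv, abs_mul, mul_assoc]
  refine mul_le_mul_of_nonneg_left ((Complex.abs_re_le_norm _).trans ?_) (abs_nonneg _)
  rw [ofReal_sq_re, ← sq_abs, ← Real.rpow_natCast, ← Real.rpow_mul (abs_nonneg _)] at h
  have h2 : |x| ^ (1 - 2 * s) = |x| * |x| ^ (((2 : ℕ) : ℝ) * -s) := by
    rw [sub_eq_add_neg, Real.rpow_add hx', Real.rpow_one]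
    push_cast
    ring_nf
  have h3 : ‖-(x / 2 : ℂ)‖ = |x| / 2 := by simp
  rw [norm_mul, h3, h2]
  nlinarith [mul_le_mul_of_nonneg_left h hx'.le, mul_nonneg hx'.le (norm_nonneg (heatIntegral ((α - 3) / 2 - 1) x))]

lemma integrable_comp_abs {h : ℝ → ℝ} (hh : IntegrableOn h (Ioi 0)) :
    Integrable fun x => h |x| := by
  have h1 : IntegrableOn (fun x => h |x|) (Ioi 0) :=
    hh.congr_fun (fun x hx => by rw [abs_of_pos hx]) measurableSet_Ioi
  have h2 : IntegrableOn (fun x => h |x|) (Iio 0) := by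
    have := (neg_zero (G := ℝ) ▸ h1).comp_neg_Iio
    simpa using this
  rw [← integrableOn_univ, ← Iio_union_Ici (a := (0 : ℝ)), integrableOn_union,
    integrableOn_Ici_iff_integrableOn_Ioi]
  exact ⟨h2, h1⟩

lemma integrable_deriv_besselKernel {α : ℝ} (hα : 1 < α) :
    Integrable (deriv (besselKernel α)) := by
  -- Integrability of |x|^(1-2s) at 0 needs s < 1, while the derivative bound needs s > (3-α)/2;
  -- both are possible because α > 1. At infinity s = 2 gives |x|^(-3).
  obtain ⟨s, hs, hs1⟩ : ∃ s, max 0 ((3 - α) / 2) < s ∧ s < 1 :=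
    exists_between (max_lt one_pos (by linarith))
  obtain ⟨hs0, hs2⟩ := max_lt_iff.1 hs
  obtain ⟨C₁, hC₁⟩ := exists_abs_deriv_besselKernel_le hα hs0 hs2
  obtain ⟨C₂, hC₂⟩ := exists_abs_deriv_besselKernel_le (s := 2) hα two_pos (by linarith)
  set h : ℝ → ℝ := fun x => if x ≤ 1 then C₁ * x ^ (1 - 2 * s) else C₂ * x ^ (1 - 2 * 2 : ℝ)
    with hh
  have hint : IntegrableOn h (Ioi 0) := by
    rw [← Ioc_union_Ioi_eq_Ioi (zero_le_one (α := ℝ)), integrableOn_union]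
    constructor
    · refine IntegrableOn.congr_fun (f := fun x => C₁ * x ^ (1 - 2 * s)) ?_
        (fun x hx => by simp [hh, hx.2]) measurableSet_Ioc
      have := (intervalIntegral.intervalIntegrable_rpow' (a := 0) (b := 1)
        (r := 1 - 2 * s) (by linarith)).const_mul C₁
      rwa [intervalIntegrable_iff_integrableOn_Ioc_of_le zero_le_one] at this
    · refine IntegrableOn.congr_fun (f := fun x => C₂ * x ^ (1 - 2 * 2 : ℝ)) ?_
        (fun x hx => by simp [hh, not_le.2 (mem_Ioi.1 hx)]) measurableSet_Ioi
      exact (integrableOn_Ioi_rpow_of_lt (by norm_num) one_pos).const_mul C₂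
  refine (integrable_comp_abs hint).mono' (measurable_deriv _).aestronglyMeasurable ?_
  filter_upwards [compl_mem_ae_iff.2 (measure_singleton (0 : ℝ))] with x hx
  simp only [hh, Real.norm_eq_abs]
  split_ifs
  exacts [hC₁ x hx, hC₂ x hx]

/-- Differentiability is known only off 0; continuity of K and integrability of K' carry the
fundamental theorem across that point. -/
lemma integral_deriv_besselKernel {α : ℝ} (hα : 1 < α) (a b : ℝ) :
    ∫ x in a..b, deriv (besselKernel α) x = besselKernel α b - besselKernel α a :=
  integral_eq_of_hasDerivAt_off_countable _ _ (countable_singleton 0)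
    (continuous_besselKernel hα).continuousOn
    (fun _ hx => (hasDerivAt_besselKernel hα hx.2).differentiableAt.hasDerivAt)
    (integrable_deriv_besselKernel hα).intervalIntegrable

/-! ### Gain of one derivative -/

lemma besselOp_eq_convolution (α : ℝ) (f : ℝ → ℝ) :
    besselOp α f = f ⋆[ContinuousLinearMap.mul ℝ ℝ, volume] besselKernel α := by
  ext x
  simp only [besselOp, convolution_def, ContinuousLinearMap.mul_apply', mul_comm]

lemma continuous_besselOp_of_integrable {α : ℝ} (hα : 1 < α) {f : ℝ → ℝ} (hf : Integrable f) :
    Continuous (besselOp α f) := by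
  obtain ⟨M, hM⟩ := exists_abs_besselKernel_le α
  rw [besselOp_eq_convolution]
  refine BddAbove.continuous_convolution_right_of_integrable _ ⟨M, ?_⟩ hf
    (continuous_besselKernel hα)
  rintro _ ⟨x, rfl⟩
  exact hM x

lemma integrable_besselKernel_sub_mul {α : ℝ} (hα : 1 < α) {f : ℝ → ℝ}
    (hf : AEStronglyMeasurable f) {C : ℝ} (hC : ∀ x, |f x| ≤ C) (x : ℝ) :
    Integrable fun y => besselKernel α (x - y) * f y :=
  ((integrable_besselKernel hα).comp_sub_left x).mul_bdd hf (Eventually.of_forall hC)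

/-- Fubini applied to K(b - y) - K(a - y) = ∫ K'. It exhibits f * K' as the derivative of Lf once f
* K' is continuous. -/
lemma besselOp_sub_eq_integral {α : ℝ} (hα : 1 < α) {f : ℝ → ℝ} (hf : Integrable f)
    {C : ℝ} (hC : ∀ x, |f x| ≤ C) (a b : ℝ) :
    besselOp α f b - besselOp α f a =
      ∫ x in a..b, (f ⋆[ContinuousLinearMap.mul ℝ ℝ, volume] deriv (besselKernel α)) x := by
  have hint := (hf.convolution_integrand (ContinuousLinearMap.mul ℝ ℝ) (μ := volume)
    (integrable_deriv_besselKernel hα))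
  have hK := integrable_besselKernel_sub_mul hα hf.aestronglyMeasurable hC
  rw [besselOp, besselOp, ← integral_sub (hK b) (hK a)]
  simp only [convolution_def, ContinuousLinearMap.mul_apply']
  rw [intervalIntegral_integral_swap]
  · congr 1 with y
    rw [intervalIntegral.integral_const_mul,
      intervalIntegral.integral_comp_sub_right (deriv (besselKernel α)),
      integral_deriv_besselKernel hα]
    ring
  · refine hint.mono_measure ?_
    exact Measure.prod_mono Measure.restrict_le_self le_rfl

/-- The operator `besselOp α` gains one derivative on compactly supported functions. -/
lemma contDiff_besselOp {α : ℝ} (hα : 1 < α) {f : ℝ → ℝ} (hcs : HasCompactSupport f) {n : ℕ}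
    (hf : ContDiff ℝ n f) : ContDiff ℝ (n + 1) (besselOp α f) := by
  set G := f ⋆[ContinuousLinearMap.mul ℝ ℝ, volume] deriv (besselKernel α) with hG
  have hGn : ContDiff ℝ n G := hcs.contDiff_convolution_left (n := n) _ hf
    (integrable_deriv_besselKernel hα).locallyIntegrable
  have hfi : Integrable f := hf.continuous.integrable_of_hasCompactSupport hcs
  obtain ⟨C, hC⟩ := hcs.exists_bound_of_continuous hf.continuous
  have heq : besselOp α f = fun b => besselOp α f 0 + ∫ x in (0 : ℝ)..b, G x := by
    ext b
    rw [← besselOp_sub_eq_integral hα hfi hC]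
    ring
  have hd : ∀ x, HasDerivAt (besselOp α f) (G x) x := fun x => by
    rw [heq]
    exact (intervalIntegral.integral_hasDerivAt_right (hGn.continuous.intervalIntegrable _ _)
      (hGn.continuous.stronglyMeasurableAtFilter _ _) hGn.continuous.continuousAt).const_add _
  rw [contDiff_succ_iff_deriv]
  refine ⟨fun x => (hd x).differentiableAt, by simp, ?_⟩
  rwa [funext fun x => (hd x).deriv]

/-! ### Analyticity away from the support -/

/-- With radius δ/4, the real part of z - y is at least 3/4 of |x₀ - y| in size and the imaginary
part at most 1/4 of it; 9/16 - 1/16 = 1/2. -/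
lemma sector_bounds {x₀ δ y : ℝ} {z : ℂ} (hδ : 0 < δ) (hy : δ ≤ |x₀ - y|)
    (hz : z ∈ Metric.ball (x₀ : ℂ) (δ / 4)) :
    (x₀ - y) ^ 2 / 2 ≤ ((z - y) ^ 2).re ∧ ‖z - y‖ ≤ 2 * |x₀ - y| := by
  have hzn : ‖z - x₀‖ < δ / 4 := by simpa [dist_eq_norm] using hz
  have hre := (Complex.abs_re_le_norm (z - x₀)).trans hzn.le
  have him := (Complex.abs_im_le_norm (z - x₀)).trans hzn.le
  simp only [Complex.sub_re, Complex.sub_im, Complex.ofReal_re, Complex.ofReal_im, sub_zero]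
    at hre him
  constructor
  · have h1 : ((z - y) ^ 2).re = (z.re - y) ^ 2 - z.im ^ 2 := by
      simp [sq]
    have h2 : z.im ^ 2 ≤ (|x₀ - y| / 4) ^ 2 := by
      rw [← sq_abs]
      gcongr
      linarith
    have h3 : (3 / 4 * |x₀ - y|) ^ 2 ≤ (z.re - y) ^ 2 := by
      rw [← sq_abs (z.re - y)]
      gcongr
      have : |x₀ - y| ≤ |z.re - x₀| + |z.re - y| := by
        rw [abs_sub_comm z.re x₀]
        exact abs_sub_le _ _ _
      linarith
    rw [h1]
    nlinarith [sq_abs (x₀ - y)]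
  · have h4 : ‖(x₀ : ℂ) - y‖ = |x₀ - y| := by
      rw [← Complex.ofReal_sub, Complex.norm_real, Real.norm_eq_abs]
    have : ‖z - y‖ ≤ ‖z - x₀‖ + ‖(x₀ : ℂ) - y‖ := norm_sub_le_norm_sub_add_norm_sub _ _ _
    linarith

lemma rpow_neg_le_of_half_sq_le {s u v : ℝ} (hs : 0 < s) (hu : 0 < u) (h : u ^ 2 / 2 ≤ v) :
    v ^ (-s) ≤ (2 : ℝ) ^ s * (u ^ 2) ^ (-s) := by
  have h1 := Real.rpow_le_rpow_of_nonpos (by positivity) h (neg_nonpos.2 hs.le)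
  rwa [Real.div_rpow (by positivity) (by norm_num), Real.rpow_neg (by norm_num : (0:ℝ) ≤ 2),
    div_inv_eq_mul, mul_comm] at h1

/-- One complex derivative under the integral already gives analyticity. Decay with s = 1 for the
integrand and s = 2 for its derivative bounds both by multiples of (x₀ - y)^(-2) on the support of
g. -/
lemma analyticAt_integral_heatIntegral_sub_mul {β : ℝ} (hβ : -2 < β) {g : ℝ → ℝ}
    (hg : AEStronglyMeasurable g) {C : ℝ} (hC : ∀ x, |g x| ≤ C) {x₀ δ : ℝ} (hδ : 0 < δ)
    (hg0 : ∀ y, |x₀ - y| < δ → g y = 0) :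
    (∀ z ∈ Metric.ball (x₀ : ℂ) (δ / 4), Integrable fun y : ℝ => heatIntegral β (z - y) * g y) ∧
    AnalyticAt ℂ (fun z : ℂ => ∫ y : ℝ, heatIntegral β (z - y) * g y) x₀ := by
  have hC0 : 0 ≤ C := (abs_nonneg _).trans (hC 0)
  obtain ⟨A, hA0, hA⟩ := exists_norm_heatIntegral_le (β := β) (s := 1) one_pos (by linarith)
  obtain ⟨B, hB0, hB⟩ := exists_norm_heatIntegral_le (β := β - 1) (s := 2) two_pos (by linarith)
  have hmeas : ∀ γ : ℝ, ∀ z : ℂ,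
      AEStronglyMeasurable (fun y : ℝ => heatIntegral γ (z - y) * g y) := fun γ z =>
    ((measurable_heatIntegral γ).comp (by fun_prop)).aestronglyMeasurable.mul
      (Complex.continuous_ofReal.comp_aestronglyMeasurable hg)
  have hgn : ∀ y, ‖(g y : ℂ)‖ ≤ C := fun y => by rw [Complex.norm_real]; exact hC y
  have hdec : Integrable fun y : ℝ => (1 + (x₀ - y) ^ 2)⁻¹ :=
    integrable_inv_one_add_sq.comp_sub_left x₀
  have hsq : ∀ y, δ ≤ |x₀ - y| → ((x₀ - y) ^ 2)⁻¹ ≤ (1 + 1 / δ ^ 2) * (1 + (x₀ - y) ^ 2)⁻¹ := by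
    intro y hy
    have h1 : δ ^ 2 ≤ (x₀ - y) ^ 2 := by
      rw [← sq_abs (x₀ - y)]
      gcongr
    have h0 : 0 < (x₀ - y) ^ 2 := lt_of_lt_of_le (by positivity) h1
    rw [← div_eq_mul_inv, inv_eq_one_div, div_le_div_iff₀ h0 (by positivity), one_mul, add_mul,
      one_mul, add_comm, add_le_add_iff_left, one_div, ← div_eq_inv_mul, one_le_div (by positivity)]
    exact h1
  have hint : ∀ z ∈ Metric.ball (x₀ : ℂ) (δ / 4),
      Integrable fun y : ℝ => heatIntegral β (z - y) * g y := by
    intro z hz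
    refine (hdec.const_mul (A * 2 * (1 + 1 / δ ^ 2) * C)).mono' (hmeas β z)
      (Eventually.of_forall fun y => ?_)
    rcases lt_or_ge |x₀ - y| δ with hy | hy
    · rw [hg0 y hy, Complex.ofReal_zero, mul_zero, norm_zero]
      positivity
    obtain ⟨hb, -⟩ := sector_bounds hδ hy hz
    have hu : 0 < |x₀ - y| := hδ.trans_le hy
    rw [← sq_abs] at hb
    have h1 := hA (z - y) (lt_of_lt_of_le (by positivity) hb)
    have h2 := rpow_neg_le_of_half_sq_le one_pos hu hb
    rw [Real.rpow_one, sq_abs, Real.rpow_neg_one ((x₀ - y) ^ 2)] at h2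
    rw [norm_mul]
    calc _ ≤ (A * (2 * ((1 + 1 / δ ^ 2) * (1 + (x₀ - y) ^ 2)⁻¹))) * C := by
          refine mul_le_mul (h1.trans ?_) (hgn y) (norm_nonneg _) (by positivity)
          exact mul_le_mul_of_nonneg_left
            (h2.trans (mul_le_mul_of_nonneg_left (hsq y hy) zero_le_two)) hA0
      _ = _ := by ring
  refine ⟨hint, ?_⟩
  refine DifferentiableOn.analyticAt (s := Metric.ball (x₀ : ℂ) (δ / 4)) (fun z hz => ?_)
    (Metric.ball_mem_nhds _ (by positivity))
  refine (hasDerivAt_integral_of_dominated_loc_of_deriv_le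
    (F' := fun z y => -((z - y) / 2) * heatIntegral (β - 1) (z - y) * g y)
    (bound := fun y => B * 4 / δ * (1 + 1 / δ ^ 2) * C * (1 + (x₀ - y) ^ 2)⁻¹)
    (Metric.isOpen_ball.mem_nhds hz) (Eventually.of_forall (hmeas β)) (hint z hz)
    ?_ ?_ (hdec.const_mul _) ?_).2.differentiableAt.differentiableWithinAt
  · simp only [mul_assoc]
    exact (by fun_prop : Measurable fun y : ℝ => -((z - y) / 2)).aestronglyMeasurable.mul
      (hmeas (β - 1) z)
  · refine Eventually.of_forall fun y z hz => ?_
    rcases lt_or_ge |x₀ - y| δ with hy | hy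
    · rw [hg0 y hy, Complex.ofReal_zero, mul_zero, norm_zero]
      positivity
    obtain ⟨hb, hn⟩ := sector_bounds hδ hy hz
    have hu : 0 < |x₀ - y| := hδ.trans_le hy
    rw [← sq_abs] at hb
    have h1 := hB (z - y) (lt_of_lt_of_le (by positivity) hb)
    have h2 := rpow_neg_le_of_half_sq_le two_pos hu hb
    have h3 : ‖-((z - y) / 2)‖ ≤ |x₀ - y| := by
      rw [norm_neg, norm_div, Complex.norm_ofNat]
      linarith
    have h4 : |x₀ - y| * (|x₀ - y| ^ 2) ^ (-2 : ℝ) ≤ 1 / δ * ((x₀ - y) ^ 2)⁻¹ := by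
      have h5 : |x₀ - y| * (|x₀ - y| ^ 2) ^ (-2 : ℝ) = 1 / |x₀ - y| * ((x₀ - y) ^ 2)⁻¹ := by
        rw [← sq_abs (x₀ - y), Real.rpow_neg (by positivity), Real.rpow_two]
        field_simp
      rw [h5]
      gcongr
    rw [norm_mul, norm_mul]
    calc _ ≤ (|x₀ - y| * (B * (2 ^ (2 : ℝ) * (|x₀ - y| ^ 2) ^ (-2 : ℝ)))) * C := by
          gcongr
          · exact h1.trans (mul_le_mul_of_nonneg_left h2 hB0)
          · exact hgn y
      _ = (B * 4 * C) * (|x₀ - y| * (|x₀ - y| ^ 2) ^ (-2 : ℝ)) := by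
          rw [Real.rpow_two]
          ring
      _ ≤ (B * 4 * C) * (1 / δ * ((1 + 1 / δ ^ 2) * (1 + (x₀ - y) ^ 2)⁻¹)) := by
          exact mul_le_mul_of_nonneg_left
            (h4.trans (mul_le_mul_of_nonneg_left (hsq y hy) (by positivity))) (by positivity)
      _ = _ := by ring
  · refine Eventually.of_forall fun y z hz => ?_
    rcases lt_or_ge |x₀ - y| δ with hy | hy
    · simp only [hg0 y hy, Complex.ofReal_zero, mul_zero]
      exact hasDerivAt_const _ _
    obtain ⟨hb, -⟩ := sector_bounds hδ hy hz
    have hu : 0 < |x₀ - y| := hδ.trans_le hy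
    rw [← sq_abs] at hb
    exact ((hasDerivAt_heatIntegral β (lt_of_lt_of_le (by positivity) hb)).comp_sub_const
      z (y : ℂ)).mul_const _

/-- `besselOp α g` is smooth away from the support of `g`. -/
lemma contDiffAt_besselOp_of_eq_zero {α : ℝ} (hα : 1 < α) {g : ℝ → ℝ}
    (hg : AEStronglyMeasurable g) {C : ℝ} (hC : ∀ x, |g x| ≤ C) {x₀ δ : ℝ} (hδ : 0 < δ)
    (hg0 : ∀ y, |x₀ - y| < δ → g y = 0) {n : WithTop ℕ∞} :
    ContDiffAt ℝ n (besselOp α g) x₀ := by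
  obtain ⟨hint, han⟩ := analyticAt_integral_heatIntegral_sub_mul (β := (α - 3) / 2)
    (by linarith) hg hC hδ hg0
  have h := (contDiffAt_const (c := besselConst α)).mul
    (han.contDiffAt (n := n)).real_of_complex
  refine h.congr_of_eventuallyEq ?_
  filter_upwards [Metric.ball_mem_nhds x₀ (by positivity : 0 < δ / 4)] with x hx
  have hx' : (x : ℂ) ∈ Metric.ball (x₀ : ℂ) (δ / 4) := by
    simpa [Complex.dist_eq, ← Complex.ofReal_sub, Real.dist_eq] using hx
  have h1 := Complex.reCLM.integral_comp_comm (hint x hx')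
  simp only [Complex.reCLM_apply] at h1
  rw [besselOp, ← h1, ← integral_const_mul]
  congr 1 with y
  rw [besselKernel_eq hα, Complex.re_mul_ofReal, Complex.ofReal_sub, mul_assoc]

/-! ### Localisation and bootstrap -/

variable {α μ : ℝ} {φ : ℝ → ℝ}

/-- Localisation: up to a smooth function, `besselOp α f` near a point only depends on the
restriction of `f` to a neighbourhood of that point. -/
lemma exists_localization (hα : 1 < α) (hf : AEStronglyMeasurable φ) {C : ℝ}
    (hC : ∀ x, |φ x| ≤ C) {U : Set ℝ} (hU : IsOpen U) {x₀ : ℝ} (hx₀ : x₀ ∈ U) :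
    ∃ f g : ℝ → ℝ, HasCompactSupport f ∧ Integrable f ∧
      (∀ n : ℕ, ContDiffOn ℝ n φ U → ContDiff ℝ n f) ∧ (∀ n : ℕ, ContDiffAt ℝ n g x₀) ∧
      besselOp α φ = besselOp α f + g := by
  obtain ⟨r, hr, hrU⟩ := Metric.isOpen_iff.1 hU x₀ hx₀
  -- The inner radius makes (1 - χ)φ vanish near x₀; the outer one keeps the support of χφ inside U.
  let χ : ContDiffBump x₀ := ⟨r / 4, r / 2, by positivity, by linarith⟩
  have hχm : AEStronglyMeasurable χ := χ.continuous.aestronglyMeasurable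
  have hχ1 : ∀ x, |1 - χ x| ≤ 1 := fun x => by
    rw [abs_le]
    constructor <;> linarith [χ.nonneg (x := x), χ.le_one (x := x)]
  have hχ0 : ∀ x, |χ x| ≤ 1 := fun x => by
    rw [abs_of_nonneg χ.nonneg]
    exact χ.le_one
  have hfb : ∀ x, |χ x * φ x| ≤ C := fun x => by
    rw [abs_mul]
    simpa using mul_le_mul (hχ0 x) (hC x) (abs_nonneg _) zero_le_one
  have hgb : ∀ x, |(1 - χ x) * φ x| ≤ C := fun x => by
    rw [abs_mul]
    simpa using mul_le_mul (hχ1 x) (hC x) (abs_nonneg _) zero_le_one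
  have hfm : AEStronglyMeasurable fun x => χ x * φ x := hχm.mul hf
  have hgm : AEStronglyMeasurable fun x => (1 - χ x) * φ x :=
    (aestronglyMeasurable_const.sub hχm).mul hf
  refine ⟨fun x => χ x * φ x, besselOp α fun x => (1 - χ x) * φ x,
    χ.hasCompactSupport.mul_right, ?_, fun n hn => ?_, fun n => ?_, ?_⟩
  · exact (χ.continuous.integrable_of_hasCompactSupport χ.hasCompactSupport).mul_bdd hf
      (Eventually.of_forall hC)
  · rw [contDiff_iff_contDiffAt]
    intro x
    by_cases hx : x ∈ tsupport χ
    · refine χ.contDiffAt.mul ((hn.contDiffAt (hU.mem_nhds (hrU ?_))))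
      rw [χ.tsupport_eq] at hx
      exact Metric.closedBall_subset_ball (by change r / 2 < r; linarith) hx
    · refine (contDiffAt_const (c := (0 : ℝ))).congr_of_eventuallyEq ?_
      filter_upwards [notMem_tsupport_iff_eventuallyEq.1 hx] with y hy
      rw [hy]
      simp
  · refine contDiffAt_besselOp_of_eq_zero hα hgm hgb (δ := r / 4) (by positivity) fun y hy => ?_
    have : χ y = 1 := χ.one_of_mem_closedBall (by
      rw [Metric.mem_closedBall, Real.dist_eq, abs_sub_comm]
      exact hy.le)
    rw [this]
    ring
  · ext x
    rw [Pi.add_apply, besselOp, besselOp, besselOp,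
      ← integral_add (integrable_besselKernel_sub_mul hα hfm hfb x)
        (integrable_besselKernel_sub_mul hα hgm hgb x)]
    congr 1 with y
    ring

lemma IsBoundedSolution.eq_sub_sqrt (hφ : IsBoundedSolution α μ φ) (hle : ∀ x, φ x ≤ μ) (x : ℝ) :
    φ x = μ - √(μ ^ 2 - 2 * besselOp α φ x) := by
  have h : μ ^ 2 - 2 * besselOp α φ x = (μ - φ x) ^ 2 := by linarith [hφ.equation x]
  rw [h, Real.sqrt_sq (by linarith [hle x])]
  ring

lemma IsBoundedSolution.contDiffAt (hφ : IsBoundedSolution α μ φ) (hle : ∀ x, φ x ≤ μ) {x : ℝ}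
    (hx : φ x < μ) {n : ℕ} (h : ContDiffAt ℝ n (besselOp α φ) x) : ContDiffAt ℝ n φ x := by
  have h0 : μ ^ 2 - 2 * besselOp α φ x ≠ 0 := by
    have h : μ ^ 2 - 2 * besselOp α φ x = (μ - φ x) ^ 2 := by linarith [hφ.equation x]
    rw [h]
    exact pow_ne_zero _ (by linarith)
  have := contDiffAt_const (c := μ).sub
    ((contDiffAt_const (c := μ ^ 2).sub (contDiffAt_const (c := (2 : ℝ)).mul h)).sqrt h0)
  exact this.congr_of_eventuallyEq (Eventually.of_forall (hφ.eq_sub_sqrt hle))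

lemma IsBoundedSolution.contDiffOn (hα : 1 < α) (hφ : IsBoundedSolution α μ φ)
    (hle : ∀ x, φ x ≤ μ) {U : Set ℝ} (hU : IsOpen U) (hlt : ∀ x ∈ U, φ x < μ) (n : ℕ) :
    ContDiffOn ℝ n φ U := by
  obtain ⟨C, hC⟩ := hφ.bounded
  induction n with
  -- Here φ is only bounded and measurable: K bounded and continuous makes Lf continuous for
  -- integrable f, and the square root preserves continuity.
  | zero =>
    refine contDiffOn_zero.2 fun x hx => ContinuousAt.continuousWithinAt ?_
    obtain ⟨f, g, -, hfi, -, hg, heq⟩ :=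
      exists_localization hα hφ.aestronglyMeasurable hC hU hx
    have hc : ContinuousAt (besselOp α φ) x := by
      rw [heq]
      exact (continuous_besselOp_of_integrable hα hfi).continuousAt.add (hg 0).continuousAt
    rw [funext (hφ.eq_sub_sqrt hle)]
    exact continuousAt_const.sub (continuousAt_const.sub (continuousAt_const.mul hc)).sqrt
  | succ n ih =>
    intro x hx
    obtain ⟨f, g, hcs, -, hf, hg, heq⟩ :=
      exists_localization hα hφ.aestronglyMeasurable hC hU hx
    refine (hφ.contDiffAt hle (hlt x hx) ?_).contDiffWithinAt
    rw [heq]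
    exact ContDiffAt.add (contDiff_besselOp hα hcs (hf n ih)).contDiffAt (hg (n + 1))

end

theorem theorem4p3 (α : ℝ) (hα : 1 < α) (μ : ℝ) (φ : ℝ → ℝ)
    (hφ : IsBoundedSolution α μ φ) (hle : ∀ x : ℝ, φ x ≤ μ) :
    ((∃ ε : ℝ, 0 < ε ∧ ∀ x : ℝ, φ x ≤ μ - ε) → ContDiff ℝ ∞ φ) ∧
    (∀ U : Set ℝ, IsOpen U → (∀ x ∈ U, φ x < μ) → ContDiffOn ℝ ∞ φ U) := by
  have key : ∀ U : Set ℝ, IsOpen U → (∀ x ∈ U, φ x < μ) → ContDiffOn ℝ ∞ φ U :=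
    fun U hU hlt => contDiffOn_infty.2 (hφ.contDiffOn hα hle hU hlt)
  refine ⟨fun ⟨ε, hε, h⟩ => ?_, key⟩
  exact contDiffOn_univ.1 (key univ isOpen_univ fun x _ => by linarith [h x])
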